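/- For $0<s<1$ let $\mathcal D_s$ be the weighted Dirichlet space of all holomorphic functions $f(z)=\sum_{n\ge 0}a_nz^n$ on the open unit disc $\mathbb D$ with $\sum_{n\ge 0}(n+1)^{1-s}|a_n|^2<\infty$, a Hilbert space with the inner product $$\langle f,g\rangle=\sum_{n=0}^\infty\frac{\Gamma(n+1)\Gamma(s)}{\Gamma(n+s)}\,a_n\overline{b_n},\qquad f=\sum_{n\ge 0} a_nz^n,\quad g=\sum_{n\ge 0} b_nz^n.$$ The numerical range of a bounded linear operator $T$ on $\mathcal D_s$ is $W(T)=\{\langle Tf,f\rangle: f\in\mathcal D_s,\ \|f\|=1\}$. Theorem 1.1. Let $0<s<1$, let $\varphi:\mathbb D\to\mathbb D$ and $\psi:\mathbb D\to\mathbb C$ be holomorphic, and suppose that the weighted composition operator $C_{\psi,\varphi}f=\psi\cdot(f\circ\varphi)$ is a bounded operator from $\mathcal D_s$ to itself. (i) If $\varphi$ is the identity map of $\mathbb D$ and $\psi$ has a zero in $\mathbb D$, then $0\in W(C_{\psi,\varphi})$. (ii) If $\varphi$ is the identity map of $\mathbb D$ and there is a point $z_0$ of the unit circle $\mathbb T$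 to which $\psi$ extends continuously with value $0$ (that is, $\psi(z)\to 0$ as $z\to z_0$ with $z\in\mathbb D$), then $0\in\overline{W(C_{\psi,\varphi})}$. (iii) If $\varphi$ is not the identity map of $\mathbb D$, then $0\in\overline{W(C_{\psi,\varphi})}$. -/

import Mathlib

open Complex.UnitDisc

noncomputable section

namespace WeightedDirichlet

/-- The extension by zero to `ℂ` of a function on the open unit disc `𝔻`. -/
def ext (f : 𝔻 → ℂ) : ℂ → ℂ := Function.extend (fun z : 𝔻 => (z : ℂ)) f 0

/-- Holomorphic functions on the open unit disc. -/
def IsHolomorphic (f : 𝔻 → ℂ) : Prop := DifferentiableOn ℂ (ext f) (Metric.ball 0 1)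

/-- The `n`-th Taylor coefficient at the origin of a function on the disc. -/
def coeff (f : 𝔻 → ℂ) (n : ℕ) : ℂ := (n.factorial : ℂ)⁻¹ * iteratedDeriv n (ext f) 0

theorem ext_coe (f : 𝔻 → ℂ) (z : 𝔻) : ext f (z : ℂ) = f z :=
  Complex.UnitDisc.coe_injective.extend_apply f 0 z

theorem ext_zero : ext 0 = 0 := by
  simp only [ext, Function.extend_zero]

theorem ext_add (f g : 𝔻 → ℂ) : ext (f + g) = ext f + ext g := by
  have h := Function.extend_add (fun z : 𝔻 => (z : ℂ)) f g (0 : ℂ → ℂ) 0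
  simpa [ext] using h

theorem ext_smul (c : ℂ) (f : 𝔻 → ℂ) : ext (c • f) = c • ext f := by
  have h := Function.extend_smul c (fun z : 𝔻 => (z : ℂ)) f (0 : ℂ → ℂ)
  simpa [ext] using h

theorem IsHolomorphic.contDiffAt {f : 𝔻 → ℂ} (hf : IsHolomorphic f) (n : ℕ) :
    ContDiffAt ℂ n (ext f) 0 :=
  (hf.contDiffOn Metric.isOpen_ball).contDiffAt
    (Metric.isOpen_ball.mem_nhds (Metric.mem_ball_self one_pos))

theorem coeff_add {f g : 𝔻 → ℂ} (hf : IsHolomorphic f) (hg : IsHolomorphic g) (n : ℕ) :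
    coeff (f + g) n = coeff f n + coeff g n := by
  rw [coeff, ext_add, iteratedDeriv_add (hf.contDiffAt n) (hg.contDiffAt n), mul_add]
  rfl

theorem coeff_smul (c : ℂ) {f : 𝔻 → ℂ} (hf : IsHolomorphic f) (n : ℕ) :
    coeff (c • f) n = c * coeff f n := by
  rw [coeff, ext_smul, iteratedDeriv_const_smul (hf.contDiffAt n), coeff, smul_eq_mul]
  ring

theorem coeff_zero (n : ℕ) : coeff 0 n = 0 := by
  have h : IsHolomorphic 0 := by
    rw [IsHolomorphic, ext_zero]; exact differentiableOn_const 0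
  simpa using coeff_smul 0 h n

/-- A holomorphic function on the disc is the sum of its power series. -/
theorem IsHolomorphic.hasSum {f : 𝔻 → ℂ} (hf : IsHolomorphic f) (z : 𝔻) :
    HasSum (fun n : ℕ => coeff f n * (z : ℂ) ^ n) (f z) := by
  have hz : (z : ℂ) ∈ Metric.ball (0 : ℂ) 1 := by
    simpa using z.norm_lt_one
  have h := Complex.hasSum_taylorSeries_on_ball hf hz
  rw [ext_coe] at h
  convert! h using 2 with n
  simp only [coeff, sub_zero, smul_eq_mul]
  ring

theorem sq_norm_add_le (a b : ℂ) : ‖a + b‖ ^ 2 ≤ 2 * ‖a‖ ^ 2 + 2 * ‖b‖ ^ 2 := by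
  nlinarith [norm_add_le a b, norm_nonneg (a + b), sq_nonneg (‖a‖ - ‖b‖), norm_nonneg a,
    norm_nonneg b]

/-- The weighted Dirichlet space `𝒟_s`, as a linear subspace of the functions on the disc: the
holomorphic `f = ∑ a_n z^n` with `∑ (n+1)^(1-s) |a_n|² < ∞`. -/
def submodule (s : ℝ) : Submodule ℂ (𝔻 → ℂ) where
  carrier := {f | IsHolomorphic f ∧
    Summable fun n : ℕ => ((n : ℝ) + 1) ^ (1 - s) * ‖coeff f n‖ ^ 2}
  zero_mem' := by
    refine ⟨?_, ?_⟩
    · rw [IsHolomorphic, ext_zero]; exact differentiableOn_const 0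
    · simp [coeff_zero]
  add_mem' := by
    rintro f g ⟨hf, hf'⟩ ⟨hg, hg'⟩
    refine ⟨?_, ?_⟩
    · rw [IsHolomorphic, ext_add]; exact hf.add hg
    · refine Summable.of_nonneg_of_le (fun n => by positivity) (fun n => ?_)
        ((hf'.mul_left 2).add (hg'.mul_left 2))
      rw [coeff_add hf hg]
      have h0 : (0 : ℝ) ≤ ((n : ℝ) + 1) ^ (1 - s) := by positivity
      nlinarith [mul_le_mul_of_nonneg_left (sq_norm_add_le (coeff f n) (coeff g n)) h0]
  smul_mem' := by
    rintro c f ⟨hf, hf'⟩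
    refine ⟨?_, ?_⟩
    · rw [IsHolomorphic, ext_smul]; exact hf.const_smul c
    · refine (hf'.mul_left (‖c‖ ^ 2)).congr (fun n => ?_)
      rw [coeff_smul c hf, norm_mul]
      ring

/-- The weights `Γ(n+1) Γ(s) / Γ(n+s)` of the inner product. -/
def weight (s : ℝ) (n : ℕ) : ℝ :=
  Real.Gamma (n + 1) * Real.Gamma s / Real.Gamma (n + s)

theorem weight_pos {s : ℝ} (hs : 0 < s) (n : ℕ) : 0 < weight s n := by
  have h1 : 0 < Real.Gamma ((n : ℝ) + 1) := Real.Gamma_pos_of_pos (by positivity)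
  have h2 : 0 < Real.Gamma s := Real.Gamma_pos_of_pos hs
  have h3 : 0 < Real.Gamma ((n : ℝ) + s) := Real.Gamma_pos_of_pos (by positivity)
  unfold weight
  positivity

theorem weight_le {s : ℝ} (hs : 0 < s) (hs1 : s < 1) (n : ℕ) :
    weight s n ≤ Real.Gamma s * ((n : ℝ) + 1) ^ (1 - s) := by
  have hp : 0 < (n : ℝ) + s := by positivity
  have h2 : 0 < Real.Gamma s := Real.Gamma_pos_of_pos hs
  have h3 : 0 < Real.Gamma ((n : ℝ) + s) := Real.Gamma_pos_of_pos hp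
  have hc := Real.Gamma_mul_add_mul_le_rpow_Gamma_mul_rpow_Gamma hp
    (add_pos hp one_pos) hs (sub_pos.2 hs1) (by ring)
  have e : s * ((n : ℝ) + s) + (1 - s) * ((n : ℝ) + s + 1) = n + 1 := by ring
  rw [e, Real.Gamma_add_one hp.ne', Real.mul_rpow hp.le h3.le] at hc
  have e2 : Real.Gamma ((n : ℝ) + s) ^ s * Real.Gamma ((n : ℝ) + s) ^ (1 - s)
      = Real.Gamma ((n : ℝ) + s) := by
    rw [← Real.rpow_add h3]; simp
  have hc' : Real.Gamma ((n : ℝ) + 1) ≤ ((n : ℝ) + s) ^ (1 - s) * Real.Gamma ((n : ℝ) + s) := by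
    calc _ ≤ _ := hc
      _ = ((n : ℝ) + s) ^ (1 - s) *
          (Real.Gamma ((n : ℝ) + s) ^ s * Real.Gamma ((n : ℝ) + s) ^ (1 - s)) := by ring
      _ = _ := by rw [e2]
  have hm : ((n : ℝ) + s) ^ (1 - s) ≤ ((n : ℝ) + 1) ^ (1 - s) :=
    Real.rpow_le_rpow hp.le (by linarith) (by linarith)
  unfold weight
  rw [div_le_iff₀ h3]
  calc Real.Gamma ((n : ℝ) + 1) * Real.Gamma s
      ≤ (((n : ℝ) + s) ^ (1 - s) * Real.Gamma ((n : ℝ) + s)) * Real.Gamma s :=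
        mul_le_mul_of_nonneg_right hc' h2.le
    _ ≤ (((n : ℝ) + 1) ^ (1 - s) * Real.Gamma ((n : ℝ) + s)) * Real.Gamma s := by gcongr
    _ = _ := by ring

/-- The weighted Dirichlet space `𝒟_s` as a type. It is kept apart from the submodule so that it
carries the Hilbert space topology and not that of pointwise convergence. -/
def Space (s : ℝ) : Type := submodule s

instance (s : ℝ) : AddCommGroup (Space s) := inferInstanceAs (AddCommGroup (submodule s))

instance (s : ℝ) : Module ℂ (Space s) := inferInstanceAs (Module ℂ (submodule s))

instance (s : ℝ) : CoeFun (Space s) (fun _ => 𝔻 → ℂ) := ⟨fun f => f.1⟩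

/-- The inner product `⟨f, g⟩ = ∑ Γ(n+1)Γ(s)/Γ(n+s) a_n conj(b_n)` of `f = ∑ a_n z^n` and
`g = ∑ b_n z^n`, linear in the first variable `f`. -/
def pairing {s : ℝ} (f g : Space s) : ℂ :=
  ∑' n : ℕ, (weight s n : ℂ) * coeff f n * (starRingEnd ℂ) (coeff g n)

theorem summable_pairing {s : ℝ} (hs : 0 < s) (hs1 : s < 1) (f g : Space s) :
    Summable fun n : ℕ => (weight s n : ℂ) * coeff f n * (starRingEnd ℂ) (coeff g n) := by
  refine Summable.of_norm_bounded
    (((f.2.2).mul_left (Real.Gamma s)).add ((g.2.2).mul_left (Real.Gamma s))) (fun n => ?_)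
  have hw := weight_le hs hs1 n
  have hw0 := (weight_pos hs n).le
  rw [norm_mul, norm_mul, RCLike.norm_conj, Complex.norm_real, Real.norm_of_nonneg hw0]
  have h1 : ‖coeff f n‖ * ‖coeff g n‖ ≤ ‖coeff f n‖ ^ 2 + ‖coeff g n‖ ^ 2 := by
    nlinarith [sq_nonneg (‖coeff f n‖ - ‖coeff g n‖), sq_nonneg ‖coeff f n‖,
      sq_nonneg ‖coeff g n‖]
  calc weight s n * ‖coeff f n‖ * ‖coeff g n‖
      = weight s n * (‖coeff f n‖ * ‖coeff g n‖) := by ring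
    _ ≤ (Real.Gamma s * ((n : ℝ) + 1) ^ (1 - s)) * (‖coeff f n‖ ^ 2 + ‖coeff g n‖ ^ 2) :=
        mul_le_mul hw h1 (by positivity) (hw0.trans hw)
    _ = _ := by ring

theorem pairing_self {s : ℝ} (f : Space s) :
    pairing f f = ((∑' n : ℕ, weight s n * ‖coeff f n‖ ^ 2 : ℝ) : ℂ) := by
  rw [pairing, Complex.ofReal_tsum]
  refine tsum_congr (fun n => ?_)
  rw [mul_assoc, Complex.mul_conj']
  push_cast
  rfl

/-- The inner product of `𝒟_s` in the convention of Mathlib, where `inner` is linear in the second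
variable: `inner ℂ g f = ⟨f, g⟩`. -/
abbrev core (s : ℝ) (hs : 0 < s) (hs1 : s < 1) : InnerProductSpace.Core ℂ (Space s) where
  inner g f := pairing f g
  conj_inner_symm f g := by
    change (starRingEnd ℂ) (pairing f g) = pairing g f
    rw [pairing, pairing, Complex.conj_tsum]
    refine tsum_congr (fun n => ?_)
    simp only [map_mul, Complex.conj_conj, Complex.conj_ofReal]
    ring
  re_inner_nonneg f := by
    change 0 ≤ (pairing f f).re
    rw [pairing_self, Complex.ofReal_re]
    exact tsum_nonneg (fun n => mul_nonneg (weight_pos hs n).le (sq_nonneg _))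
  add_left f g h := by
    change pairing h (f + g) = pairing h f + pairing h g
    rw [pairing, pairing, pairing,
      ← (summable_pairing hs hs1 h f).tsum_add (summable_pairing hs hs1 h g)]
    refine tsum_congr (fun n => ?_)
    have e : coeff (f + g : Space s) n = coeff f n + coeff g n := coeff_add f.2.1 g.2.1 n
    rw [e, map_add]
    ring
  smul_left f g c := by
    change pairing g (c • f) = (starRingEnd ℂ) c * pairing g f
    rw [pairing, pairing, ← tsum_mul_left]
    refine tsum_congr (fun n => ?_)
    have e : coeff (c • f : Space s) n = c * coeff f n := coeff_smul c f.2.1 n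
    rw [e, map_mul]
    ring
  definite f h := by
    change pairing f f = 0 at h
    have hsum : Summable fun n : ℕ => weight s n * ‖coeff f n‖ ^ 2 := by
      refine Summable.of_nonneg_of_le
        (fun n => mul_nonneg (weight_pos hs n).le (sq_nonneg _)) (fun n => ?_)
        ((f.2.2).mul_left (Real.Gamma s))
      rw [← mul_assoc]
      exact mul_le_mul_of_nonneg_right (weight_le hs hs1 n) (sq_nonneg _)
    rw [pairing_self, Complex.ofReal_eq_zero] at h
    have h0 := (hasSum_zero_iff_of_nonneg
      (fun n => mul_nonneg (weight_pos hs n).le (sq_nonneg ‖coeff f n‖))).1 (h ▸ hsum.hasSum)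
    have hc : ∀ n, coeff f n = 0 := by
      intro n
      have := congrFun h0 n
      simpa [(weight_pos hs n).ne'] using this
    refine Subtype.ext (funext fun z => ?_)
    have hz := f.2.1.hasSum z
    simp only [hc, zero_mul] at hz
    exact hz.unique hasSum_zero

section

variable (s : ℝ) [hs : Fact (s ∈ Set.Ioo (0 : ℝ) 1)]

instance : NormedAddCommGroup (Space s) :=
  (core s hs.out.1 hs.out.2).toNormedAddCommGroup

instance : InnerProductSpace ℂ (Space s) :=
  InnerProductSpace.ofCore (core s hs.out.1 hs.out.2).toCore

theorem inner_def (f g : Space s) :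
    inner ℂ g f = ∑' n : ℕ, (weight s n : ℂ) * coeff f n * (starRingEnd ℂ) (coeff g n) := rfl

end

/-- The numerical range `W(T) = {⟨T f, f⟩ : ‖f‖ = 1}` of a bounded operator. -/
def numericalRange {H : Type*} [NormedAddCommGroup H] [InnerProductSpace ℂ H] (T : H →L[ℂ] H) :
    Set ℂ :=
  {w | ∃ f : H, ‖f‖ = 1 ∧ w = inner ℂ f (T f)}

/-- The weighted composition `f ↦ ψ · (f ∘ φ)` on functions on the disc. -/
def weightedComp (ψ : 𝔻 → ℂ) (φ : 𝔻 → 𝔻) (f : 𝔻 → ℂ) : 𝔻 → ℂ := fun z => ψ z * f (φ z)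

/-- `T` is the weighted composition operator `C_{ψ,φ}`, as a bounded operator on `𝒟_s`. -/
def IsWeightedCompOp {s : ℝ} [Fact (s ∈ Set.Ioo (0 : ℝ) 1)] (ψ : 𝔻 → ℂ) (φ : 𝔻 → 𝔻)
    (T : Space s →L[ℂ] Space s) : Prop :=
  ∀ f : Space s, (T f : 𝔻 → ℂ) = weightedComp ψ φ f

end WeightedDirichlet

end

/-! The inner product makes `K_w(z) = (1 - conj w z)^(-s)` the reproducing kernel, with `‖K_w‖² = (1
- |w|²)^(-s)`. Testing the operator on normalised kernels puts `ψ(w) K_w(φ w) / ‖K_w‖²` in the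
numerical range (`IsWeightedCompOp.mem_numericalRange`). For `φ = id` this value is `ψ(w)`, which
settles the first two claims. Otherwise, suppose the numerical range keeps a distance `ε` from `0`.
Since `ψ = T 1` lies in the space, `|ψ(w)| ≤ ‖T 1‖ ‖K_w‖`, so `|1 - conj w φ(w)|^s ≤ (‖T 1‖/ε) (1 -
|w|²)^(s/2)`. Hence `φ(w) - w` tends to `0` uniformly at the circle (`norm_sub_le`), and the maximum
principle gives `φ = id`. -/

namespace WeightedDirichlet

/-! ### Weights and kernel functions. -/

open Filter Topology ComplexConjugate

/-- These are the binomial coefficients of `(1 - x)^(-s)`; both sides equal the rising factorial of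
`s` divided by `n!`. -/
theorem choose_eq_inv_weight {s : ℝ} (hs : 0 < s) (n : ℕ) :
    Ring.choose ((s : ℂ) + n - 1) n = ((weight s n)⁻¹ : ℝ) := by
  have hp := Complex.Gamma_add_nat_div_Gamma_eq (n := n) (s : ℂ) (fun k hk => by
    have h1 : s = -(k : ℝ) := by exact_mod_cast hk
    have h2 : (0 : ℝ) ≤ k := k.cast_nonneg
    linarith)
  have hm := Ring.factorial_nsmul_multichoose_eq_ascPochhammer (s : ℂ) n
  rw [Polynomial.ascPochhammer_smeval_eq_eval, ← hp, nsmul_eq_mul] at hm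
  have hn : (n.factorial : ℂ) ≠ 0 := by exact_mod_cast n.factorial_ne_zero
  rw [← Ring.multichoose_eq, eq_div_of_mul_eq hn ((mul_comm _ _).trans hm), weight,
    Real.Gamma_nat_eq_factorial, inv_div]
  push_cast [← Complex.Gamma_ofReal]
  rw [div_div, mul_comm (n.factorial : ℂ), add_comm (s : ℂ)]

/-- Consecutive weights have ratio `(n + 1)/(n + s) ≥ 1`. This bounds the kernel coefficients by
`|w|^n`. -/
theorem one_le_weight {s : ℝ} (hs : 0 < s) (hs1 : s < 1) (n : ℕ) : 1 ≤ weight s n := by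
  induction n with
  | zero =>
    have := (Real.Gamma_pos_of_pos hs).ne'
    simp [weight, this]
  | succ n ih =>
    have hp : 0 < (n : ℝ) + s := by positivity
    have h : weight s (n + 1) = weight s n * (((n : ℝ) + 1) / (n + s)) := by
      have h3 := (Real.Gamma_pos_of_pos hp).ne'
      have h4 := Real.Gamma_add_one (s := (n : ℝ) + 1) (by positivity)
      have h5 := Real.Gamma_add_one hp.ne'
      rw [weight, weight]
      push_cast
      rw [h4, show (n : ℝ) + 1 + s = n + s + 1 by ring, h5]
      field_simp
    rw [h]
    have : 1 ≤ ((n : ℝ) + 1) / (n + s) := by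
      rw [one_le_div hp]; linarith
    exact one_le_mul_of_one_le_of_one_le ih this

/-- The reproducing kernel `z ↦ (1 - conj w z)^(-s)` at the point `w`. -/
noncomputable def kernelFun (s : ℝ) (w z : 𝔻) : ℂ := 1 / (1 - conj (w : ℂ) * (z : ℂ)) ^ (s : ℂ)

theorem norm_conj_mul_lt_one (w z : 𝔻) : ‖conj (w : ℂ) * (z : ℂ)‖ < 1 := by
  simpa using (star w * z).norm_lt_one

theorem norm_one_sub_pos (w z : 𝔻) : 0 < ‖1 - conj (w : ℂ) * (z : ℂ)‖ := by
  rw [norm_pos_iff, sub_ne_zero]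
  intro h
  have := norm_conj_mul_lt_one w z
  rw [← h, norm_one] at this
  exact lt_irrefl _ this

theorem norm_kernelFun (s : ℝ) (w z : 𝔻) :
    ‖kernelFun s w z‖ = (‖1 - conj (w : ℂ) * (z : ℂ)‖ ^ s)⁻¹ := by
  rw [kernelFun, norm_div, norm_one, Complex.norm_cpow_real, one_div]

theorem ext_kernelFun (s : ℝ) (w : 𝔻) :
    Set.EqOn (ext (kernelFun s w)) (fun z => 1 / (1 - conj (w : ℂ) * z) ^ (s : ℂ))
      (Metric.ball 0 1) := by
  intro z hz
  have hz' : ‖z‖ < 1 := by simpa using hz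
  lift z to 𝔻 using hz'
  exact ext_coe _ z

theorem isHolomorphic_kernelFun (s : ℝ) (w : 𝔻) : IsHolomorphic (kernelFun s w) := by
  refine DifferentiableOn.congr (fun z hz => ?_) (ext_kernelFun s w)
  have hz' : ‖z‖ < 1 := by simpa using hz
  lift z to 𝔻 using hz'
  have hm : 1 - conj (w : ℂ) * (z : ℂ) ∈ Complex.slitPlane := by
    rw [sub_eq_add_neg]
    exact Complex.mem_slitPlane_of_norm_lt_one (by
      rw [norm_neg]; exact norm_conj_mul_lt_one w z)
  have h0 : (1 - conj (w : ℂ) * (z : ℂ)) ^ (s : ℂ) ≠ 0 := by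
    rw [Complex.cpow_def_of_ne_zero (Complex.slitPlane_ne_zero hm)]
    exact Complex.exp_ne_zero _
  have hd : DifferentiableAt ℂ (fun z : ℂ => 1 - conj (w : ℂ) * z) z := by fun_prop
  exact ((differentiableAt_const 1).div (hd.cpow_const hm) h0).differentiableWithinAt

theorem coeff_kernelFun {s : ℝ} (hs : 0 < s) (w : 𝔻) (n : ℕ) :
    coeff (kernelFun s w) n = ((weight s n)⁻¹ : ℝ) * conj (w : ℂ) ^ n := by
  have h1 := (Complex.one_div_one_sub_cpow_hasFPowerSeriesOnBall_zero (s : ℂ))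
  -- The centre `0` is written as the image of `0` so that the binomial series can be composed with
  -- `z ↦ conj w * z`.
  rw [← map_zero (conj (w : ℂ) • (1 : ℂ →L[ℂ] ℂ))] at h1
  have h2 := h1.compContinuousLinearMap.hasFPowerSeriesAt
  have h3 : (fun x : ℂ => 1 / (1 - x) ^ (s : ℂ)) ∘ (conj (w : ℂ) • (1 : ℂ →L[ℂ] ℂ))
      =ᶠ[𝓝 0] ext (kernelFun s w) := by
    filter_upwards [Metric.isOpen_ball.mem_nhds (Metric.mem_ball_self (zero_lt_one' ℝ))] with z hz
    rw [ext_kernelFun s w hz]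
    simp
  have h4 := h2.congr h3
  have h5 := h4.eq_formalMultilinearSeries h4.analyticAt.hasFPowerSeriesAt
  have h6 := congrArg (fun p => p.coeff n) h5
  simp only [FormalMultilinearSeries.coeff_ofScalars] at h6
  rw [coeff, inv_mul_eq_div, ← h6, ← choose_eq_inv_weight hs]
  rw [FormalMultilinearSeries.coeff, FormalMultilinearSeries.compContinuousLinearMap_apply]
  simp [Function.comp_def, mul_comm]

theorem kernelFun_mem {s : ℝ} (hs : 0 < s) (hs1 : s < 1) (w : 𝔻) :
    kernelFun s w ∈ submodule s := by
  refine ⟨isHolomorphic_kernelFun s w, ?_⟩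
  have hw : ‖‖(w : ℂ)‖ ^ 2‖ < 1 := by
    rw [norm_pow, norm_norm]; exact w.sq_norm_lt_one
  have hg : Summable fun n : ℕ => ((n : ℝ) + 1) * (‖(w : ℂ)‖ ^ 2) ^ n := by
    simpa [add_mul] using
      (summable_pow_mul_geometric_of_norm_lt_one 1 hw).add (summable_geometric_of_norm_lt_one hw)
  refine Summable.of_nonneg_of_le (fun n => by positivity) (fun n => ?_) hg
  have h1 : ((n : ℝ) + 1) ^ (1 - s) ≤ (n : ℝ) + 1 := by
    have := Real.rpow_le_rpow_of_exponent_le (x := (n : ℝ) + 1) (y := 1 - s) (z := 1)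
      (by linarith [n.cast_nonneg (α := ℝ)]) (by linarith)
    rwa [Real.rpow_one] at this
  have h2 : ‖coeff (kernelFun s w) n‖ ≤ ‖(w : ℂ)‖ ^ n := by
    rw [coeff_kernelFun hs, norm_mul, norm_pow, RCLike.norm_conj, Complex.norm_real,
      Real.norm_of_nonneg (inv_nonneg.2 (weight_pos hs n).le)]
    exact mul_le_of_le_one_left (by positivity) (inv_le_one_of_one_le₀ (one_le_weight hs hs1 n))
  rw [← pow_mul, mul_comm 2 n, pow_mul]
  gcongr

/-! ### The reproducing property and kernel norms. -/

section

variable (s : ℝ) [hs : Fact (s ∈ Set.Ioo (0 : ℝ) 1)]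

/-- The reproducing kernel at `w` as an element of `𝒟_s`. -/
noncomputable def kernel (w : 𝔻) : Space s := ⟨kernelFun s w, kernelFun_mem hs.out.1 hs.out.2 w⟩

variable {s}

/-- The reproducing property. -/
theorem inner_kernel (w : 𝔻) (f : Space s) : inner ℂ (kernel s w) f = f w := by
  rw [inner_def, ← (f.2.1.hasSum w).tsum_eq]
  refine tsum_congr fun n => ?_
  have hw : ((weight s n : ℝ) : ℂ) ≠ 0 := by exact_mod_cast (weight_pos hs.out.1 n).ne'
  have hk : coeff (kernel s w) n = ((weight s n)⁻¹ : ℝ) * conj (w : ℂ) ^ n :=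
    coeff_kernelFun hs.out.1 w n
  rw [hk]
  simp only [map_mul, map_pow, Complex.conj_conj, Complex.conj_ofReal]
  push_cast
  field_simp

theorem norm_kernel_sq (w : 𝔻) : ‖kernel s w‖ ^ 2 = ((1 - ‖(w : ℂ)‖ ^ 2) ^ s)⁻¹ := by
  -- Passing to norms replaces the complex power by a real one.
  have h : ‖inner ℂ (kernel s w) (kernel s w)‖ = ‖kernelFun s w w‖ :=
    congrArg _ (inner_kernel w (kernel s w))
  rw [norm_kernelFun, inner_self_eq_norm_sq_to_K, Complex.conj_mul'] at h
  have h1 : (1 : ℂ) - (‖(w : ℂ)‖ : ℂ) ^ 2 = ((1 - ‖(w : ℂ)‖ ^ 2 : ℝ) : ℂ) := by push_cast; rfl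
  rw [h1, Complex.norm_real, Real.norm_of_nonneg (by linarith [w.sq_norm_lt_one])] at h
  rw [← h]
  simp

theorem norm_kernel_pos (w : 𝔻) : 0 < ‖kernel s w‖ := by
  have h : 0 < ‖kernel s w‖ ^ 2 := by
    rw [norm_kernel_sq]
    have := w.sq_norm_lt_one
    exact inv_pos.2 (Real.rpow_pos_of_pos (by linarith) _)
  exact (norm_nonneg _).lt_of_ne' fun h0 => by simp [h0] at h

/-- Provides the constant function `1` as an element of the space, so that `T (kernel s 0)` is `ψ`.
-/
theorem kernel_zero_apply (z : 𝔻) : kernel s 0 z = 1 := by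
  change kernelFun s 0 z = 1
  simp [kernelFun]

theorem norm_apply_le (f : Space s) (w : 𝔻) : ‖f w‖ ≤ ‖f‖ * ‖kernel s w‖ := by
  rw [← inner_kernel, mul_comm]
  exact norm_inner_le_norm _ _

end

/-! ### Numerical range values at normalised kernels. -/

theorem div_norm_sq_mem_numericalRange {H : Type*} [NormedAddCommGroup H] [InnerProductSpace ℂ H]
    (T : H →L[ℂ] H) {f : H} (hf : 0 < ‖f‖) :
    inner ℂ f (T f) / (‖f‖ : ℂ) ^ 2 ∈ numericalRange T := by
  refine ⟨((‖f‖⁻¹ : ℝ) : ℂ) • f, ?_, ?_⟩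
  · rw [norm_smul, Complex.norm_real, norm_inv, norm_norm, inv_mul_cancel₀ hf.ne']
  · rw [map_smul, inner_smul_left, inner_smul_right, Complex.conj_ofReal]
    push_cast
    ring

section

variable {s : ℝ} [hs : Fact (s ∈ Set.Ioo (0 : ℝ) 1)] {φ : 𝔻 → 𝔻} {ψ : 𝔻 → ℂ}
  {T : Space s →L[ℂ] Space s}

theorem IsWeightedCompOp.inner_kernel_apply (hT : IsWeightedCompOp ψ φ T) (w : 𝔻) :
    inner ℂ (kernel s w) (T (kernel s w)) = ψ w * kernelFun s w (φ w) := by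
  rw [inner_kernel, hT]
  rfl

theorem IsWeightedCompOp.mem_numericalRange (hT : IsWeightedCompOp ψ φ T) (w : 𝔻) :
    ψ w * kernelFun s w (φ w) / (‖kernel s w‖ : ℂ) ^ 2 ∈ numericalRange T := by
  rw [← hT.inner_kernel_apply]
  exact div_norm_sq_mem_numericalRange T (norm_kernel_pos w)

theorem IsWeightedCompOp.apply_mem_numericalRange (hT : IsWeightedCompOp ψ id T) (w : 𝔻) :
    ψ w ∈ numericalRange T := by
  have h := hT.mem_numericalRange w
  have h1 : kernelFun s w w = (‖kernel s w‖ : ℂ) ^ 2 :=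
    (inner_kernel w (kernel s w)).symm.trans (inner_self_eq_norm_sq_to_K _)
  have h2 : (‖kernel s w‖ : ℂ) ^ 2 ≠ 0 := by
    exact_mod_cast (pow_pos (norm_kernel_pos w) 2).ne'
  rwa [id, h1, mul_div_cancel_right₀ _ h2] at h

theorem IsWeightedCompOp.norm_weight_le (hT : IsWeightedCompOp ψ φ T) (w : 𝔻) :
    ‖ψ w‖ ≤ ‖T (kernel s 0)‖ * ‖kernel s w‖ := by
  have h := norm_apply_le (T (kernel s 0)) w
  rwa [hT, weightedComp, kernel_zero_apply, mul_one] at h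

/-- If the numerical range stays away from `0`, then `φ w` is close to `w` near the circle. -/
theorem IsWeightedCompOp.norm_one_sub_rpow_le (hT : IsWeightedCompOp ψ φ T) {ε : ℝ} (hε : 0 < ε)
    (h : ∀ v ∈ numericalRange T, ε ≤ ‖v‖) (w : 𝔻) :
    ‖1 - conj (w : ℂ) * (φ w : ℂ)‖ ^ s ≤
      ‖T (kernel s 0)‖ / ε * (1 - ‖(w : ℂ)‖ ^ 2) ^ (s / 2) := by
  have hk := norm_kernel_pos (s := s) w
  have hd : 0 < ‖1 - conj (w : ℂ) * (φ w : ℂ)‖ ^ s :=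
    Real.rpow_pos_of_pos (norm_one_sub_pos w (φ w)) _
  have h0 : 0 < 1 - ‖(w : ℂ)‖ ^ 2 := by linarith [w.sq_norm_lt_one]
  have h1 := h _ (hT.mem_numericalRange w)
  have h2 := hT.norm_weight_le w
  have hkn : ‖kernel s w‖ * (1 - ‖(w : ℂ)‖ ^ 2) ^ (s / 2) = 1 := by
    have hr : 0 < (1 - ‖(w : ℂ)‖ ^ 2) ^ (s / 2) := Real.rpow_pos_of_pos h0 _
    have hsq : (‖kernel s w‖ * (1 - ‖(w : ℂ)‖ ^ 2) ^ (s / 2)) ^ 2 = 1 := by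
      rw [mul_pow, norm_kernel_sq, ← Real.rpow_natCast (_ ^ (s / 2)) 2, ← Real.rpow_mul h0.le]
      have : s / 2 * ((2 : ℕ) : ℝ) = s := by push_cast; ring
      rw [this]
      exact inv_mul_cancel₀ (Real.rpow_pos_of_pos h0 _).ne'
    exact (pow_eq_one_iff_of_nonneg (by positivity) two_ne_zero).1 hsq
  rw [norm_div, norm_mul, norm_kernelFun, norm_pow, Complex.norm_real, norm_norm,
    le_div_iff₀ (by positivity), ← div_eq_mul_inv, le_div_iff₀ hd] at h1
  rw [div_mul_eq_mul_div, le_div_iff₀ hε]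
  -- `h1` carries `‖K_w‖²` on the left and `h2` only `‖K_w‖` on the right; the spare factor is the
  -- decay `(1 - |w|²)^(s/2)`, by `hkn`.
  refine le_of_mul_le_mul_left ?_ (pow_pos hk 2)
  calc ‖kernel s w‖ ^ 2 * (‖1 - conj (w : ℂ) * (φ w : ℂ)‖ ^ s * ε)
      = ε * ‖kernel s w‖ ^ 2 * ‖1 - conj (w : ℂ) * (φ w : ℂ)‖ ^ s := by ring
    _ ≤ ‖T (kernel s 0)‖ * ‖kernel s w‖ := h1.trans h2
    _ = ‖T (kernel s 0)‖ * ‖kernel s w‖ * (‖kernel s w‖ * (1 - ‖(w : ℂ)‖ ^ 2) ^ (s / 2)) := by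
        rw [hkn, mul_one]
    _ = _ := by ring

end

/-! ### Rigidity of `φ` from its boundary behaviour. -/

/-- A holomorphic function on the disc which tends to `0` at the circle, uniformly, vanishes. -/
theorem eq_zero_of_norm_le_of_tendsto {g : ℂ → ℂ} (hg : DifferentiableOn ℂ g (Metric.ball 0 1))
    {b : ℝ → ℝ} (hb : Tendsto b (𝓝[<] 1) (𝓝 0)) (h : ∀ z : 𝔻, ‖g z‖ ≤ b ‖(z : ℂ)‖) (z : 𝔻) :
    g z = 0 := by
  rw [← norm_le_zero_iff]
  -- For every `r` in `(|z|, 1)` the maximum principle on the disc of radius `r` gives `‖g z‖ ≤ b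
  -- r`.
  refine ge_of_tendsto hb ?_
  filter_upwards [Ioo_mem_nhdsLT z.norm_lt_one] with r hr
  have hr0 : 0 < r := (norm_nonneg _).trans_lt hr.1
  have hsub : Metric.closedBall (0 : ℂ) r ⊆ Metric.ball 0 1 := Metric.closedBall_subset_ball hr.2
  refine Complex.norm_le_of_forall_mem_frontier_norm_le (U := Metric.ball 0 r)
    Metric.isBounded_ball (hg.diffContOnCl_ball hsub) (fun w hw => ?_)
    (subset_closure (by simpa using hr.1))
  rw [frontier_ball _ hr0.ne', mem_sphere_zero_iff_norm] at hw
  have hw1 : ‖w‖ < 1 := hw.trans_lt hr.2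
  lift w to 𝔻 using hw1
  exact hw ▸ h w

/-- Follows from `z - w = (1 - |w|²) z - w (1 - conj w z)`. -/
theorem norm_sub_le (w z : 𝔻) :
    ‖(z : ℂ) - w‖ ≤ ‖1 - conj (w : ℂ) * (z : ℂ)‖ + (1 - ‖(w : ℂ)‖ ^ 2) := by
  have e : (z : ℂ) - w = ((1 - ‖(w : ℂ)‖ ^ 2 : ℝ) : ℂ) * z - w * (1 - conj (w : ℂ) * z) := by
    have := Complex.mul_conj' (w : ℂ)
    push_cast
    linear_combination -(z : ℂ) * this
  have h0 : 0 ≤ 1 - ‖(w : ℂ)‖ ^ 2 := by linarith [w.sq_norm_lt_one]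
  rw [e]
  refine (_root_.norm_sub_le _ _).trans ?_
  rw [norm_mul, norm_mul, Complex.norm_real, Real.norm_of_nonneg h0, add_comm]
  exact add_le_add (mul_le_of_le_one_left (norm_nonneg _) w.norm_lt_one.le)
    (mul_le_of_le_one_right h0 z.norm_lt_one.le)

theorem IsWeightedCompOp.zero_mem_closure_numericalRange {s : ℝ}
    [hs : Fact (s ∈ Set.Ioo (0 : ℝ) 1)] {φ : 𝔻 → 𝔻} {ψ : 𝔻 → ℂ} {T : Space s →L[ℂ] Space s}
    (hT : IsWeightedCompOp ψ φ T) (hφ : IsHolomorphic (fun z => (φ z : ℂ))) (hne : φ ≠ id) :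
    (0 : ℂ) ∈ closure (numericalRange T) := by
  by_contra h0
  rw [Metric.mem_closure_iff] at h0
  push Not at h0
  obtain ⟨ε, hε, h⟩ := h0
  simp only [dist_zero_left] at h
  have hs0 : 0 < s := hs.out.1
  set C := ‖T (kernel s 0)‖ / ε with hC
  -- The bound for `|φ(w) - w|` at `|w| = r`. Positive exponents make it continuous on all of `ℝ`,
  -- with value `0` at `r = 1`.
  have hlim : Tendsto (fun r : ℝ => (C * (1 - r ^ 2) ^ (s / 2)) ^ s⁻¹ + (1 - r ^ 2))
      (𝓝[<] 1) (𝓝 0) := by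
    have hcont : Continuous fun r : ℝ => (C * (1 - r ^ 2) ^ (s / 2)) ^ s⁻¹ + (1 - r ^ 2) := by
      have h1 : Continuous fun r : ℝ => (1 - r ^ 2) ^ (s / 2) :=
        Continuous.rpow_const (by fun_prop) fun _ => Or.inr (by positivity)
      exact ((h1.const_mul C).rpow_const fun _ => Or.inr (by positivity)).add (by fun_prop)
    have := hcont.tendsto 1
    rw [one_pow, sub_self, Real.zero_rpow (by positivity), mul_zero,
      Real.zero_rpow (by positivity), add_zero] at this
    exact this.mono_left nhdsWithin_le_nhds
  refine hne (funext fun z => Complex.UnitDisc.coe_injective ?_)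
  have hd : DifferentiableOn ℂ (fun w => ext (fun z => (φ z : ℂ)) w - w) (Metric.ball 0 1) :=
    hφ.sub differentiableOn_id
  have hz := eq_zero_of_norm_le_of_tendsto hd hlim (fun w => ?_) z
  · rw [ext_coe, sub_eq_zero] at hz
    exact hz
  · rw [ext_coe]
    refine (norm_sub_le w (φ w)).trans (add_le_add_left ?_ _)
    have hle := hT.norm_one_sub_rpow_le hε h w
    have := Real.rpow_le_rpow (by positivity) hle (inv_nonneg.2 hs0.le)
    rwa [Real.rpow_rpow_inv (norm_nonneg _) hs0.ne'] at this

end WeightedDirichlet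

theorem theorem1p1 (s : ℝ) [Fact (s ∈ Set.Ioo (0 : ℝ) 1)]
    (φ : 𝔻 → 𝔻) (hφ : WeightedDirichlet.IsHolomorphic (fun z => (φ z : ℂ)))
    (ψ : 𝔻 → ℂ) (hψ : WeightedDirichlet.IsHolomorphic ψ)
    (T : WeightedDirichlet.Space s →L[ℂ] WeightedDirichlet.Space s)
    (hT : WeightedDirichlet.IsWeightedCompOp ψ φ T) :
    (φ = id → (∃ z : 𝔻, ψ z = 0) → (0 : ℂ) ∈ WeightedDirichlet.numericalRange T) ∧
    -- `ψ` extends continuously to a boundary point `z₀`, with value `0` there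
    (φ = id → (∃ z₀ : Circle, Filter.Tendsto ψ
        (Filter.comap (fun z : 𝔻 => (z : ℂ)) (nhds (z₀ : ℂ))) (nhds 0)) →
      (0 : ℂ) ∈ closure (WeightedDirichlet.numericalRange T)) ∧
    (φ ≠ id → (0 : ℂ) ∈ closure (WeightedDirichlet.numericalRange T)) := by
  refine ⟨?_, ?_, hT.zero_mem_closure_numericalRange hφ⟩
  · rintro rfl ⟨z, hz⟩
    exact hz ▸ hT.apply_mem_numericalRange z
  · rintro rfl ⟨z₀, hz₀⟩
    -- The limit hypothesis is not vacuous, since `z₀` is a limit of points of the disc.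
    have : (Filter.comap (fun z : 𝔻 => (z : ℂ)) (nhds (z₀ : ℂ))).NeBot := by
      refine Filter.comap_neBot fun t ht => ?_
      have hcl : (z₀ : ℂ) ∈ closure (Metric.ball (0 : ℂ) 1) := by
        rw [closure_ball _ one_ne_zero, mem_closedBall_zero_iff]
        exact (Circle.norm_coe z₀).le
      obtain ⟨w, hwt, hw⟩ := mem_closure_iff_nhds.1 hcl t ht
      have hw1 : ‖w‖ < 1 := by simpa using hw
      lift w to 𝔻 using hw1
      exact ⟨w, hwt⟩
    exact mem_closure_of_tendsto hz₀ (Filter.Eventually.of_forall hT.apply_mem_numericalRange)
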